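/- Let $n\ge 0$ be an integer, let $\mathrm{Sym}(2^n)$ be the symmetric group on the letters $\{1,\dots,2^n\}$, and write $x^g=g^{-1}xg$. For $m<n$ regard $\mathrm{Sym}(2^m)$ as the subgroup of $\mathrm{Sym}(2^n)$ that fixes every letter greater than $2^m$. For $1\le m\le n$ let $\mathcal B^n_m$ be the partition of $\{1,\dots,2^n\}$ into the $2^m$ blocks $\{k2^{n-m}+1,\dots,(k+1)2^{n-m}\}$, $0\le k\le 2^m-1$, and let $\Sigma_n=\bigcap_{m=1}^n \mathrm{Stab}_{\mathrm{Sym}(2^n)}(\mathcal B^n_m)$, a Sylow $2$-subgroup of $\mathrm{Sym}(2^n)$. For $i\ge 1$ put $s_i=\prod_{j=1}^{2^{i-1}}(j,\,j+2^{i-1})$, and define $t^n_n=s_n$ and $t^n_i=t^{n-1}_i\cdot(t^{n-1}_i)^{s_n}$ for $1\le i<n$. Let $T_{n,i}=\langle t^n_1,\dots,t^n_i\rangle$ for $0\le i\le n$ (so $T_{n,0}=\{1\}$), and let $T_n=T_{n,n}$, which is an elementary abelian regular subgroup of $\mathrm{Sym}(2^n)$; the chain $\{1\}=T_{n,0}<T_{n,1}<\dots<T_{n,n}=T_n$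 is a maximal flag of $T_n$. Let $U_n=N_{\Sigma_n}(T_n)=\Sigma_n\cap N_{\mathrm{Sym}(2^n)}(T_n)$ and $N^1_n=N_{\mathrm{Sym}(2^n)}(U_n)$. Proposition. The group $N^1_n$ normalizes each of the terms $T_{n,0},\dots,T_{n,n-2}$ of this flag; that is, $(T_{n,i})^g=T_{n,i}$ for every $g\in N^1_n$ and every integer $i$ with $0\le i\le n-2$. -/

import Mathlib

namespace SylowChain

/-- The set `X_n = {1, …, 2^n}`. -/
abbrev X (n : ℕ) : Type := {x : ℕ // 1 ≤ x ∧ x ≤ 2 ^ n}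

/-- The symmetric group `Sym(2^n)` on the letters `1, …, 2^n`. -/
abbrev Sym (n : ℕ) : Type := Equiv.Perm (X n)

/-- The block `B^n_{m,k} = {k 2^{n-m} + 1, …, (k+1) 2^{n-m}}` (for `m ≤ n`, `k < 2^m`). -/
def block (n m k : ℕ) : Set (X n) :=
  {x | k * 2 ^ (n - m) + 1 ≤ x.1 ∧ x.1 ≤ (k + 1) * 2 ^ (n - m)}

/-- The partition `𝓑^n_m = {B^n_{m,0}, …, B^n_{m,2^m-1}}` of `X_n` (for `m ≤ n`). -/
def blocks (n m : ℕ) : Set (Set (X n)) :=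
  {B | ∃ k : ℕ, k < 2 ^ m ∧ B = block n m k}

open scoped Pointwise in
/-- `Σ_n`, the intersection for `m = 1, …, n` of the stabilizers in `Sym(2^n)` of the
partitions `𝓑^n_m`. -/
def SigmaGroup (n : ℕ) : Subgroup (Sym n) :=
  ⨅ m ∈ Finset.Icc 1 n, MulAction.stabilizer (Sym n) (blocks n m)

/-- The inclusion `X_n ⊆ X_{n+1}`. -/
def incl (n : ℕ) (x : X n) : X (n + 1) :=
  ⟨x.1, x.2.1, x.2.2.trans (Nat.pow_le_pow_right (by norm_num) (Nat.le_succ n))⟩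

/-- The map `j ↦ j + 2^n` from `X_n` to `X_{n+1}`. -/
def shift (n : ℕ) (x : X n) : X (n + 1) :=
  ⟨x.1 + 2 ^ n, by have := x.2.1; omega, by have := x.2.2; rw [pow_succ]; omega⟩

theorem incl_injective (n : ℕ) : Function.Injective (incl n) := fun _ _ h =>
  Subtype.ext (congrArg (fun z : X (n + 1) => z.1) h)

/-- The inclusion `Sym(2^n) ≤ Sym(2^{n+1})`: a permutation of `{1, …, 2^n}` is extended so as
to fix every letter greater than `2^n`. -/
noncomputable def extendSym (n : ℕ) : Sym n →* Sym (n + 1) :=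
  Equiv.Perm.viaEmbeddingHom ⟨incl n, incl_injective n⟩

/-- The `j`-th letter of `X_n`, counting from `0`; it is the number `j + 1`. -/
def letter (n : ℕ) (j : Fin (2 ^ n)) : X n := ⟨j.1 + 1, Nat.le_add_left 1 j.1, j.2⟩

/-- The element `s_{n+1} = (1, 1+2^n) (2, 2+2^n) ⋯ (2^n, 2^n+2^n)` of `Sym(2^{n+1})`. -/
def s (n : ℕ) : Sym (n + 1) :=
  (List.ofFn fun j : Fin (2 ^ n) =>
    Equiv.swap (incl n (letter n j)) (shift n (letter n j))).prod

/-- The elements `t^n_i` of `Sym(2^n)`, meaningful for `1 ≤ i ≤ n`: `t^n_n = s_n`, and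
`t^n_i = t^{n-1}_i · (t^{n-1}_i)^{s_n}` for `1 ≤ i < n`. -/
noncomputable def t : (n i : ℕ) → Sym n
  | 0, _ => 1
  | n + 1, i =>
      if i = n + 1 then s n
      else extendSym n (t n i) * ((s n)⁻¹ * extendSym n (t n i) * s n)

/-- The term `T_{n,i} = ⟨t^n_1, …, t^n_i⟩` of the maximal flag of `T_n` (for `i ≤ n`); in
particular `T_{n,0} = {1}`. -/
def Tflag (n i : ℕ) : Subgroup (Sym n) :=
  Subgroup.closure {g | ∃ j : ℕ, 1 ≤ j ∧ j ≤ i ∧ g = t n j}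

/-- The elementary abelian regular group `T_n = T_{n,n}`. -/
def T (n : ℕ) : Subgroup (Sym n) := Tflag n n

/-- The affine group `AGL(T_n)`, that is, the normalizer of `T_n` in `Sym(2^n)`. -/
def AGL (n : ℕ) : Subgroup (Sym n) := Subgroup.normalizer (T n)

/-- `U_n = AGL(T_n) ∩ Σ_n = N_{Σ_n}(T_n)`. -/
def U (n : ℕ) : Subgroup (Sym n) := AGL n ⊓ SigmaGroup n

/-- The normalizer chain of `T_n`: `N^0_n = U_n` and `N^k_n = N_{Sym(2^n)}(N^{k-1}_n)` for
`k ≥ 1`. -/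
def N (n : ℕ) : ℕ → Subgroup (Sym n)
  | 0 => U n
  | k + 1 => Subgroup.normalizer (N n k)

end SylowChain

/-!
In terms of the binary digits of the letters, `T_n` is the group of translations of `V = 𝔽₂ⁿ`, the
terms `T_{n,i}` are the translations by the terms of the standard flag, and `U_n` is the stabilizer
of that flag in the affine group.

Let `g` normalize `U_n`, and let `v ∘ w` be the addition of `V` transported along `g`, with origin
`0`. Translations are affine for `∘` as well, since `U_n` normalizes both regular groups; hence
`B v w = v ∘ w - v - w` is biadditive, `U_n` acts on it equivariantly, and its values lie in its own
kernel. Equivariance under the shears `x ↦ x + x_j e_a` forces `B` to vanish on the terms of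
codimension at least two of the flag, because such a term leaves two indices `j` to choose from.
On the kernel of `B` the two additions agree, so `g⁻¹ * τ * g` is a translation whenever `τ` is a
translation by an element of the `i`-th term. The vectors whose translations are conjugated by `g`
into `T_{n,i}` form a subgroup invariant under the shears, hence comparable with the `i`-th term,
and finiteness turns the comparison into an equality.
-/

namespace SylowChain

open Equiv

section Translations

variable {V : Type*} [AddCommGroup V]

/-- The group of translations of `V` by the elements of a subgroup. -/
def translations (W : AddSubgroup V) : Subgroup (Perm V) :=
  (AddSubgroup.toSubgroup W).map (Equiv.constVAddHom V V)

/-- The vectors `v` such that the translation by `v` lies in a given group of permutations. -/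
def translationVectors (P : Subgroup (Perm V)) : AddSubgroup V :=
  Subgroup.toAddSubgroup' (P.comap (Equiv.constVAddHom V V))

theorem mem_translations {W : AddSubgroup V} {f : Perm V} :
    f ∈ translations W ↔ ∃ v ∈ W, Equiv.addLeft v = f :=
  Iff.rfl

theorem mem_translationVectors {P : Subgroup (Perm V)} {v : V} :
    v ∈ translationVectors P ↔ Equiv.addLeft v ∈ P :=
  Iff.rfl

theorem translations_le_iff {W : AddSubgroup V} {P : Subgroup (Perm V)} :
    translations W ≤ P ↔ W ≤ translationVectors P :=
  Subgroup.map_le_iff_le_comap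

theorem addLeft_mem_translations {W : AddSubgroup V} {v : V} :
    Equiv.addLeft v ∈ translations W ↔ v ∈ W := by
  refine ⟨fun h => ?_, fun hv => ⟨v, hv, rfl⟩⟩
  obtain ⟨w, hw, hwv⟩ := mem_translations.1 h
  have hwv0 : w = v := by simpa using congr($hwv 0)
  exact hwv0 ▸ hw

theorem conj_addLeft_eq {f : Perm V} {v : V} (h : ∀ x, f (v + x) = f v - f 0 + f x) :
    f * Equiv.addLeft v * f⁻¹ = Equiv.addLeft (f v - f 0) := by
  ext x
  simp [h]

theorem mem_normalizer_translations_iff {f : Perm V} {W : AddSubgroup V} :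
    f ∈ Subgroup.normalizer (translations W : Set (Perm V)) ↔
      (∀ v ∈ W, ∀ x, f (v + x) = f v - f 0 + f x) ∧ ∀ v, f v - f 0 ∈ W ↔ v ∈ W := by
  rw [Subgroup.mem_normalizer_iff]
  constructor
  · intro h
    have conj : ∀ v ∈ W, ∃ w ∈ W, ∀ x, f (v + x) = w + f x := fun v hv => by
      obtain ⟨w, hw, hwv⟩ := mem_translations.1 ((h _).1 (addLeft_mem_translations.2 hv))
      exact ⟨w, hw, fun x => by simpa using congr($hwv (f x)).symm⟩
    refine ⟨fun v hv x => ?_, fun v => ⟨fun hv => ?_, fun hv => ?_⟩⟩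
    · obtain ⟨w, -, hw⟩ := conj v hv
      have hw0 : f v = w + f 0 := by simpa using hw 0
      rw [hw, hw0, add_sub_cancel_right]
    · have hmem : f⁻¹ * Equiv.addLeft (f v - f 0) * f ∈ translations W := by
        rw [h]
        simpa [mul_assoc] using addLeft_mem_translations.2 hv
      obtain ⟨u, hu, huv⟩ := mem_translations.1 hmem
      have huv0 : u = v := by simpa using congr($huv 0)
      exact huv0 ▸ hu
    · obtain ⟨w, hw, hwx⟩ := conj v hv
      have hw0 : f v = w + f 0 := by simpa using hwx 0
      rwa [hw0, add_sub_cancel_right]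
  · rintro ⟨hadd, hW⟩ h
    refine ⟨?_, fun hh => ?_⟩
    · rintro ⟨v, hv, rfl⟩
      exact mem_translations.2 ⟨f v - f 0, (hW v).2 hv, (conj_addLeft_eq (hadd v hv)).symm⟩
    · obtain ⟨w, hw, hwh⟩ := mem_translations.1 hh
      obtain ⟨v, rfl⟩ : ∃ v, f v - f 0 = w := ⟨f⁻¹ (w + f 0), by simp⟩
      have hv := (hW v).1 hw
      rw [← conj_addLeft_eq (hadd v hv)] at hwh
      exact mem_translations.2 ⟨v, hv, mul_left_cancel (mul_right_cancel hwh)⟩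

theorem apply_add_of_mem_normalizer_translations {f : Perm V}
    (hf : f ∈ Subgroup.normalizer (translations (⊤ : AddSubgroup V) : Set (Perm V))) (x y : V) :
    f (x + y) = f x - f 0 + f y :=
  (mem_normalizer_translations_iff.1 hf).1 x (AddSubgroup.mem_top x) y

theorem mem_normalizer_translations_iff_sub_mem {f : Perm V}
    (hf : f ∈ Subgroup.normalizer (translations (⊤ : AddSubgroup V) : Set (Perm V)))
    {W : AddSubgroup V} :
    f ∈ Subgroup.normalizer (translations W : Set (Perm V)) ↔
      ∀ x y, f x - f y ∈ W ↔ x - y ∈ W := by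
  have hadd := apply_add_of_mem_normalizer_translations hf
  have hsub : ∀ x y, f x - f y = f (x - y) - f 0 := fun x y => by
    conv_lhs => rw [← sub_add_cancel x y, hadd, add_sub_cancel_right]
  rw [mem_normalizer_translations_iff]
  refine ⟨fun h x y => by rw [hsub, h.2], fun h => ⟨fun v _ => hadd v, fun v => ?_⟩⟩
  simpa using h v 0

theorem translations_le_normalizer_translations (W : AddSubgroup V) :
    translations (⊤ : AddSubgroup V) ≤ Subgroup.normalizer (translations W : Set (Perm V)) := by
  rintro f hf
  obtain ⟨v, -, rfl⟩ := mem_translations.1 hf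
  exact (mem_normalizer_translations_iff_sub_mem (Subgroup.le_normalizer hf)).2 fun x y => by simp

theorem addEquiv_mem_normalizer_translations {e : V ≃+ V} {W : AddSubgroup V}
    (he : ∀ v, e v ∈ W ↔ v ∈ W) :
    e.toEquiv ∈ Subgroup.normalizer (translations W : Set (Perm V)) :=
  mem_normalizer_translations_iff.2 ⟨fun v _ x => by simp, fun v => by simpa using he v⟩

end Translations

section ConjAdd

variable {V : Type*} [AddCommGroup V]

/-- The addition of `V` transported along `g`, with the origin moved back to `0`: the
permutations `conjAdd g v` are the conjugates under `g` of the translations of `V`. -/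
def conjAdd (g : Perm V) (v w : V) : V := g (g⁻¹ v + g⁻¹ w - g⁻¹ 0)

/-- The difference between the addition transported along `g` and the addition of `V`. -/
def conjAddDefect (g : Perm V) (v w : V) : V := conjAdd g v w - v - w

variable (g : Perm V)

theorem conjAdd_comm (v w : V) : conjAdd g v w = conjAdd g w v := by
  rw [conjAdd, conjAdd, add_comm (g⁻¹ v)]

theorem conjAdd_zero (v : V) : conjAdd g v 0 = v := by
  simp [conjAdd]

theorem conjAdd_eq_add_defect (v w : V) : conjAdd g v w = v + w + conjAddDefect g v w := by
  rw [conjAddDefect]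
  abel

theorem conjAddDefect_comm (v w : V) : conjAddDefect g v w = conjAddDefect g w v := by
  rw [conjAddDefect, conjAddDefect, conjAdd_comm, sub_right_comm]

theorem conj_addLeft_apply (v w : V) :
    (g * Equiv.addLeft (g⁻¹ v - g⁻¹ 0) * g⁻¹) w = conjAdd g v w := by
  simp [conjAdd, sub_add_eq_add_sub]

theorem inv_mul_addLeft_mul_of_conjAddDefect_eq_zero {v : V} (hv : ∀ w, conjAddDefect g v w = 0) :
    g⁻¹ * Equiv.addLeft v * g = Equiv.addLeft (g⁻¹ v - g⁻¹ 0) := by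
  have h : g * Equiv.addLeft (g⁻¹ v - g⁻¹ 0) * g⁻¹ = Equiv.addLeft v := by
    ext w
    rw [conj_addLeft_apply, conjAdd_eq_add_defect, hv, add_zero, Equiv.coe_addLeft]
  rw [← h]
  group

variable {g} {U : Subgroup (Perm V)} (hg : g ∈ Subgroup.normalizer (U : Set (Perm V)))
  (hTU : translations ⊤ ≤ U)
  (hU : U ≤ Subgroup.normalizer (translations (⊤ : AddSubgroup V) : Set (Perm V)))

include hg hU

theorem conjAdd_map_conjAdd {u : Perm V} (hu : u ∈ U) (v w : V) :
    conjAdd g (u (conjAdd g v w)) (u 0) = conjAdd g (u v) (u w) := by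
  have haff := apply_add_of_mem_normalizer_translations
    (hU ((Subgroup.mem_normalizer_iff''.1 hg u).1 hu))
  have h : (g⁻¹ * u * g) (g⁻¹ v + g⁻¹ w - g⁻¹ 0) + (g⁻¹ * u * g) (g⁻¹ 0) =
      (g⁻¹ * u * g) (g⁻¹ v) + (g⁻¹ * u * g) (g⁻¹ w) := by
    conv_rhs => rw [← sub_add_cancel (g⁻¹ w) (g⁻¹ 0), haff]
    rw [add_sub_assoc, haff]
    abel
  simp only [Perm.mul_apply, Perm.inv_def, Equiv.apply_symm_apply] at h
  simp only [conjAdd, Perm.inv_def, h]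

theorem map_conjAddDefect {u : Perm V} (hu : u ∈ U) (hu0 : u 0 = 0) (v w : V) :
    u (conjAddDefect g v w) = conjAddDefect g (u v) (u w) := by
  have hadd : ∀ x y, u (x + y) = u x + u y := fun x y => by
    rw [apply_add_of_mem_normalizer_translations (hU hu), hu0, sub_zero]
  have h := conjAdd_map_conjAdd hg hU hu v w
  rw [hu0, conjAdd_zero, conjAdd_eq_add_defect, hadd, hadd, conjAdd_eq_add_defect] at h
  exact add_left_cancel h

include hTU

theorem conjAdd_add_right (v x y : V) :
    conjAdd g v (x + y) = conjAdd g v x - v + conjAdd g v y := by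
  have hmem : g * Equiv.addLeft (g⁻¹ v - g⁻¹ 0) * g⁻¹ ∈ U :=
    (Subgroup.mem_normalizer_iff.1 hg _).1
      (hTU (addLeft_mem_translations.2 (AddSubgroup.mem_top _)))
  have h := apply_add_of_mem_normalizer_translations (hU hmem) x y
  simpa only [conj_addLeft_apply, conjAdd_zero] using h

theorem conjAddDefect_add_right (v x y : V) :
    conjAddDefect g v (x + y) = conjAddDefect g v x + conjAddDefect g v y := by
  simp only [conjAddDefect, conjAdd_add_right hg hTU hU]
  abel

theorem conjAddDefect_add_left (x y v : V) :
    conjAddDefect g (x + y) v = conjAddDefect g x v + conjAddDefect g y v := by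
  simp only [conjAddDefect_comm g _ v, conjAddDefect_add_right hg hTU hU]

theorem conjAddDefect_conjAddDefect (v w z : V) :
    conjAddDefect g (conjAddDefect g v w) z = 0 := by
  have hz := hTU (addLeft_mem_translations.2 (AddSubgroup.mem_top z))
  have h := conjAdd_map_conjAdd hg hU hz v w
  simp only [Equiv.coe_addLeft, add_zero, conjAdd_eq_add_defect,
    conjAddDefect_add_left hg hTU hU, conjAddDefect_add_right hg hTU hU,
    conjAddDefect_comm g z w] at h
  rw [← sub_eq_zero] at h
  rw [← h]
  abel

end ConjAdd

section Flag

variable {K : Type*} [Field K] {n : ℕ}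

variable (K n) in
/-- The `i`-th term of the standard flag of `Kⁿ`: the vectors supported on the first `i`
coordinates (the whole space when `n ≤ i`). -/
def stdFlag (i : ℕ) : Submodule K (Fin n → K) :=
  Submodule.pi {j | i ≤ j.1} fun _ => ⊥

theorem mem_stdFlag {i : ℕ} {x : Fin n → K} : x ∈ stdFlag K n i ↔ ∀ j : Fin n, i ≤ j.1 → x j = 0 :=
  Iff.rfl

theorem stdFlag_eq_top {i : ℕ} (hi : n ≤ i) : stdFlag K n i = ⊤ :=
  eq_top_iff.2 fun _ _ j hj => absurd (hi.trans hj) j.2.not_ge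

theorem single_mem_stdFlag {i : ℕ} {j : Fin n} (hj : j.1 < i) (c : K) :
    Pi.single j c ∈ stdFlag K n i :=
  mem_stdFlag.2 fun _ hk => by rw [Pi.single_eq_of_ne (Fin.ne_of_val_ne (hj.trans_le hk).ne')]

theorem stdFlag_le_iff {i : ℕ} {W : Submodule K (Fin n → K)} :
    stdFlag K n i ≤ W ↔ ∀ j : Fin n, j.1 < i → Pi.single j 1 ∈ W := by
  refine ⟨fun h j hj => h (single_mem_stdFlag hj 1), fun h x hx => ?_⟩
  rw [pi_eq_sum_univ' x]
  refine sum_mem fun j _ => ?_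
  by_cases hj : j.1 < i
  · exact W.smul_mem _ (h j hj)
  · rw [mem_stdFlag.1 hx j (not_lt.1 hj), zero_smul]
    exact W.zero_mem

/-- The elementary upper transvection `x ↦ x + x_j e_i` of `Kⁿ`, for `i < j`. -/
def shear {i j : Fin n} (h : i < j) : (Fin n → K) ≃ₗ[K] (Fin n → K) :=
  LinearEquiv.transvection (f := LinearMap.proj j) (v := Pi.single i 1) (by simp [h.ne'])

theorem shear_apply {i j : Fin n} (h : i < j) (x : Fin n → K) :
    shear h x = x + x j • Pi.single i 1 :=
  LinearEquiv.transvection.apply _ x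

theorem shear_single_same {i j : Fin n} (h : i < j) :
    shear h (Pi.single j (1 : K)) = Pi.single j 1 + Pi.single i 1 := by
  simp [shear_apply]

theorem shear_eq_self {i j : Fin n} (h : i < j) {x : Fin n → K} (hx : x j = 0) :
    shear h x = x := by
  simp [shear_apply, hx]

theorem shear_mem_stdFlag_iff {i : ℕ} {a b : Fin n} (h : a < b) {x : Fin n → K} :
    shear h x ∈ stdFlag K n i ↔ x ∈ stdFlag K n i := by
  rcases lt_or_ge a.1 i with ha | ha
  · rw [shear_apply, Submodule.add_mem_iff_left]
    exact Submodule.smul_mem _ _ (single_mem_stdFlag ha 1)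
  · have hb : (shear h x) b = x b := by simp [shear_apply, h.ne']
    have hib : i ≤ b.1 := ha.trans (Fin.lt_def.1 h).le
    constructor <;> intro hx
    · rwa [shear_eq_self h (hb ▸ mem_stdFlag.1 hx b hib)] at hx
    · rwa [shear_eq_self h (mem_stdFlag.1 hx b hib)]

theorem single_mem_of_shear_mem {W : Submodule K (Fin n → K)}
    (hW : ∀ ⦃i j : Fin n⦄ (h : i < j), ∀ x ∈ W, shear h x ∈ W)
    {x : Fin n → K} (hx : x ∈ W) {i j : Fin n} (hj : x j ≠ 0) (hij : i < j) :
    Pi.single i 1 ∈ W := by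
  have hsub := W.sub_mem (hW hij x hx) hx
  rwa [shear_apply, add_sub_cancel_left, W.smul_mem_iff hj] at hsub

theorem le_stdFlag_or_stdFlag_le {W : Submodule K (Fin n → K)}
    (hW : ∀ ⦃i j : Fin n⦄ (h : i < j), ∀ x ∈ W, shear h x ∈ W) (i : ℕ) :
    W ≤ stdFlag K n i ∨ stdFlag K n i ≤ W := by
  refine or_iff_not_imp_left.2 fun hle => stdFlag_le_iff.2 fun k hk => ?_
  obtain ⟨x, hx, hxi⟩ := SetLike.not_le_iff_exists.1 hle
  simp only [mem_stdFlag, not_forall] at hxi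
  obtain ⟨j, hij, hj⟩ := hxi
  exact single_mem_of_shear_mem hW hx hj (Fin.lt_def.2 (hk.trans_le hij))

section Bilinear

variable {B : (Fin n → K) →ₗ[K] (Fin n → K) →ₗ[K] (Fin n → K)}
  (hshear : ∀ ⦃i j : Fin n⦄ (h : i < j) (x y : Fin n → K),
    shear h (B x y) = B (shear h x) (shear h y))

include hshear

theorem shear_mem_ker ⦃i j : Fin n⦄ (h : i < j) (x : Fin n → K) (hx : x ∈ LinearMap.ker B) :
    shear h x ∈ LinearMap.ker B := by
  refine LinearMap.mem_ker.2 (LinearMap.ext fun y => ?_)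
  obtain ⟨y, rfl⟩ := (shear h).surjective y
  rw [← hshear, LinearMap.mem_ker.1 hx]
  simp

-- The value `b = B e_j e_c` has `b_j = 0`, so the shear `e_j ↦ e_j + e_a` fixes `b` and, since
-- `j ≠ c`, also `e_c`.
theorem apply_single_eq_zero (hnil : ∀ x y, B x y ∈ LinearMap.ker B) {a : Fin n}
    (ha : a.1 + 2 < n) (hker : LinearMap.ker B ≤ stdFlag K n (a + 1)) (c : Fin n) :
    B (Pi.single a 1) (Pi.single c 1) = 0 := by
  obtain ⟨j, haj, hjc⟩ := Finset.exists_mem_ne (s := Finset.Ioi a) (by simp; omega) c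
  rw [Finset.mem_Ioi] at haj
  have hBj : B (Pi.single j 1) (Pi.single c 1) j = 0 := hker (hnil _ _) j haj
  have hcj : (Pi.single c 1 : Fin n → K) j = 0 := Pi.single_eq_of_ne hjc 1
  have h := hshear haj (Pi.single j 1) (Pi.single c 1)
  rwa [shear_eq_self haj hBj, shear_eq_self haj hcj, shear_single_same, map_add,
    LinearMap.add_apply, left_eq_add] at h

theorem stdFlag_le_ker (hnil : ∀ x y, B x y ∈ LinearMap.ker B) {i : ℕ} (hi : i + 2 ≤ n) :
    stdFlag K n i ≤ LinearMap.ker B := by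
  refine stdFlag_le_iff.2 fun a ha => ?_
  rcases le_stdFlag_or_stdFlag_le (shear_mem_ker hshear) (a + 1) with hker | hker
  · refine LinearMap.mem_ker.2 ((Pi.basisFun K (Fin n)).ext fun c => ?_)
    rw [Pi.basisFun_apply, LinearMap.zero_apply]
    exact apply_single_eq_zero hshear hnil (by omega) hker c
  · exact hker (single_mem_stdFlag a.1.lt_succ_self 1)

end Bilinear

variable (K n) in
/-- The stabilizer of the standard flag in the normalizer of the translations of `Kⁿ`, a permutation
stabilizing a term of the flag when it normalizes the group of translations by that term. The whole
space is a term of the flag, so that the translations themselves are normalized. -/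
def flagStabilizer : Subgroup (Perm (Fin n → K)) :=
  ⨅ i, Subgroup.normalizer (translations (stdFlag K n i).toAddSubgroup : Set (Perm (Fin n → K)))

theorem flagStabilizer_le_normalizer (i : ℕ) :
    flagStabilizer K n ≤ Subgroup.normalizer
      (translations (stdFlag K n i).toAddSubgroup : Set (Perm (Fin n → K))) :=
  iInf_le _ i

theorem translations_le_flagStabilizer :
    translations (⊤ : AddSubgroup (Fin n → K)) ≤ flagStabilizer K n :=
  le_iInf fun _ => translations_le_normalizer_translations _

theorem flagStabilizer_le_normalizer_top :
    flagStabilizer K n ≤ Subgroup.normalizer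
      (translations (⊤ : AddSubgroup (Fin n → K)) : Set (Perm (Fin n → K))) := by
  simpa [stdFlag_eq_top le_rfl] using flagStabilizer_le_normalizer (K := K) (n := n) n

theorem mem_flagStabilizer_iff {f : Perm (Fin n → K)} :
    f ∈ flagStabilizer K n ↔
      f ∈ Subgroup.normalizer
        (translations (⊤ : AddSubgroup (Fin n → K)) : Set (Perm (Fin n → K))) ∧
      ∀ i < n, ∀ x y, f x - f y ∈ stdFlag K n i ↔ x - y ∈ stdFlag K n i := by
  refine ⟨fun hf => ?_, fun ⟨hf, h⟩ => Subgroup.mem_iInf.2 fun i => ?_⟩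
  · have hf' := flagStabilizer_le_normalizer_top hf
    exact ⟨hf', fun i _ =>
      (mem_normalizer_translations_iff_sub_mem hf').1 (flagStabilizer_le_normalizer i hf)⟩
  · refine (mem_normalizer_translations_iff_sub_mem hf).2 fun x y => ?_
    rcases lt_or_ge i n with hi | hi
    · exact h i hi x y
    · simp [stdFlag_eq_top hi]

theorem shear_mem_flagStabilizer {i j : Fin n} (h : i < j) :
    (shear h : (Fin n → K) ≃ₗ[K] (Fin n → K)).toAddEquiv.toEquiv ∈ flagStabilizer K n := by
  refine Subgroup.mem_iInf.2 fun _ => addEquiv_mem_normalizer_translations fun v => ?_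
  exact shear_mem_stdFlag_iff h

end Flag

theorem conj_conj_mem {G : Type*} [Group G] {U T : Subgroup G} {g u f : G}
    (hg : g ∈ Subgroup.normalizer (U : Set G)) (hT : U ≤ Subgroup.normalizer (T : Set G))
    (hu : u ∈ U) (hf : g * f * g⁻¹ ∈ T) : g * (u * f * u⁻¹) * g⁻¹ ∈ T := by
  have hgu := hT ((Subgroup.mem_normalizer_iff.1 hg u).1 hu)
  simpa [mul_assoc] using (Subgroup.mem_normalizer_iff.1 hgu _).1 hf

section Normalizer

variable {p n : ℕ} [Fact p.Prime] {g : Perm (Fin n → ZMod p)}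
  (hg : g ∈ Subgroup.normalizer (flagStabilizer (ZMod p) n : Set (Perm (Fin n → ZMod p))))

include hg

theorem conjAddDefect_eq_zero_of_mem_stdFlag {i : ℕ} (hi : i + 2 ≤ n) {v : Fin n → ZMod p}
    (hv : v ∈ stdFlag (ZMod p) n i) (w : Fin n → ZMod p) : conjAddDefect g v w = 0 := by
  have hT := translations_le_flagStabilizer (K := ZMod p) (n := n)
  have hN := flagStabilizer_le_normalizer_top (K := ZMod p) (n := n)
  have add_left := conjAddDefect_add_left hg hT hN
  have add_right := conjAddDefect_add_right hg hT hN
  let B : (Fin n → ZMod p) →ₗ[ZMod p] (Fin n → ZMod p) →ₗ[ZMod p] (Fin n → ZMod p) :=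
    LinearMap.mk₂ (ZMod p) (conjAddDefect g) add_left
      (fun c x y => ZMod.map_smul (AddMonoidHom.mk' (conjAddDefect g · y) (add_left · · y)) c x)
      add_right
      (fun c x y => ZMod.map_smul (AddMonoidHom.mk' (conjAddDefect g x) (add_right x)) c y)
  have hnil : ∀ x y, B x y ∈ LinearMap.ker B := fun x y =>
    LinearMap.mem_ker.2 (LinearMap.ext (conjAddDefect_conjAddDefect hg hT hN x y))
  have hshear : ∀ ⦃i j : Fin n⦄ (h : i < j) (x y : Fin n → ZMod p),
      shear h (B x y) = B (shear h x) (shear h y) := fun i j h =>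
    map_conjAddDefect hg hN (shear_mem_flagStabilizer h) (map_zero (shear h))
  exact congr($(LinearMap.mem_ker.1 (stdFlag_le_ker hshear hnil hi hv)) w)

theorem mem_normalizer_translations_stdFlag {i : ℕ} (hi : i + 2 ≤ n) :
    g ∈ Subgroup.normalizer
      (translations (stdFlag (ZMod p) n i).toAddSubgroup : Set (Perm (Fin n → ZMod p))) := by
  set T := translations (stdFlag (ZMod p) n i).toAddSubgroup
  let W := AddSubgroup.toZModSubmodule p
    (translationVectors (T.comap (MulAut.conj g).toMonoidHom))
  have mem_W {x} : x ∈ W ↔ g * Equiv.addLeft x * g⁻¹ ∈ T := Iff.rfl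
  have shear_mem_W ⦃a b : Fin n⦄ (h : a < b) (x) (hx : x ∈ W) : shear h x ∈ W := by
    have hconj := conj_conj_mem hg (flagStabilizer_le_normalizer i)
      (shear_mem_flagStabilizer h) (mem_W.1 hx)
    rw [conj_addLeft_eq fun y => by simp] at hconj
    simpa [mem_W] using hconj
  rcases le_stdFlag_or_stdFlag_le shear_mem_W i with hle | hle
  · rw [← inv_mem_iff]
    refine Subgroup.mem_normalizer_fintype ?_
    rintro _ ⟨v, hv, rfl⟩
    have hconj := inv_mul_addLeft_mul_of_conjAddDefect_eq_zero g
      (conjAddDefect_eq_zero_of_mem_stdFlag hg hi hv)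
    have hmem : g⁻¹ v - g⁻¹ 0 ∈ W := by
      rw [mem_W, ← hconj]
      simpa [mul_assoc] using addLeft_mem_translations.2 hv
    rw [inv_inv]
    exact mem_translations.2 ⟨_, hle hmem, hconj.symm⟩
  · refine Subgroup.mem_normalizer_fintype ?_
    rintro _ ⟨v, hv, rfl⟩
    exact hle hv

end Normalizer

section Letters

theorem letter_bijective (n : ℕ) : Function.Bijective (letter n) := by
  refine ⟨fun a b h => Fin.ext (by simpa [letter] using h), fun x => ?_⟩
  have := x.2
  exact ⟨⟨x.1 - 1, by omega⟩, Subtype.ext (by simp only [letter]; omega)⟩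

instance (n : ℕ) : Fintype (X n) := Fintype.ofBijective _ (letter_bijective n)

theorem card_X (n : ℕ) : Fintype.card (X n) = 2 ^ n := by
  rw [← Fintype.card_of_bijective (letter_bijective n), Fintype.card_fin]

theorem shift_injective (n : ℕ) : Function.Injective (shift n) := fun x y h => by
  simpa [shift, Subtype.ext_iff] using h

theorem incl_ne_shift {n : ℕ} (x y : X n) : incl n x ≠ shift n y := fun h => by
  have hval : x.1 = y.1 + 2 ^ n := congrArg Subtype.val h
  have := x.2
  have := y.2
  omega

theorem exists_incl_or_shift {n : ℕ} (x : X (n + 1)) :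
    (∃ y, incl n y = x) ∨ ∃ y, shift n y = x := by
  have := x.2
  have := pow_succ 2 n
  rcases le_or_gt x.1 (2 ^ n) with hx | hx
  · exact Or.inl ⟨⟨x.1, x.2.1, hx⟩, rfl⟩
  · exact Or.inr ⟨⟨x.1 - 2 ^ n, by omega⟩, Subtype.ext (by simp only [shift]; omega)⟩

end Letters

section Generators

theorem s_apply_of_swap_apply_ne {n : ℕ} {y : X n} {x : X (n + 1)}
    (hx : swap (incl n y) (shift n y) x ≠ x) : s n x = swap (incl n y) (shift n y) x := by
  obtain ⟨j, rfl⟩ := (letter_bijective n).2 y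
  refine (Perm.eq_on_support_mem_disjoint (List.mem_ofFn.2 ⟨j, rfl⟩) ?_ x
    (Perm.mem_support.2 hx)).symm
  refine List.pairwise_ofFn.2 fun a b hab => Perm.disjoint_swap_swap ?_
  have hne : letter n a ≠ letter n b := (letter_bijective n).1.ne hab.ne
  simp [incl_ne_shift, (incl_ne_shift _ _).symm, (incl_injective n).ne hne,
    (shift_injective n).ne hne]

theorem s_incl {n : ℕ} (y : X n) : s n (incl n y) = shift n y := by
  rw [s_apply_of_swap_apply_ne (y := y)] <;> simp [(incl_ne_shift y y).symm]

theorem s_shift {n : ℕ} (y : X n) : s n (shift n y) = incl n y := by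
  rw [s_apply_of_swap_apply_ne (y := y)] <;> simp [incl_ne_shift y y]

theorem extendSym_incl {n : ℕ} (f : Sym n) (y : X n) :
    extendSym n f (incl n y) = incl n (f y) :=
  Perm.viaEmbedding_apply f ⟨incl n, incl_injective n⟩ y

theorem extendSym_shift {n : ℕ} (f : Sym n) (y : X n) :
    extendSym n f (shift n y) = shift n y :=
  Perm.viaEmbedding_apply_of_notMem f ⟨incl n, incl_injective n⟩ _
    fun ⟨z, hz⟩ => incl_ne_shift z y hz

theorem t_succ_self (n : ℕ) : t (n + 1) (n + 1) = s n := by simp [t]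

theorem t_succ_of_ne {n i : ℕ} (hi : i ≠ n + 1) :
    t (n + 1) i = extendSym n (t n i) * ((s n)⁻¹ * extendSym n (t n i) * s n) := by
  rw [t, if_neg hi]

theorem t_succ_incl {n i : ℕ} (hi : i ≠ n + 1) (y : X n) :
    t (n + 1) i (incl n y) = incl n (t n i y) := by
  have hs : (s n)⁻¹ (shift n y) = incl n y := Perm.inv_eq_iff_eq.2 (s_incl y).symm
  simp only [t_succ_of_ne hi, Perm.mul_apply, s_incl, extendSym_shift, hs, extendSym_incl]

theorem t_succ_shift {n i : ℕ} (hi : i ≠ n + 1) (y : X n) :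
    t (n + 1) i (shift n y) = shift n (t n i y) := by
  have hs : (s n)⁻¹ (incl n (t n i y)) = shift n (t n i y) :=
    Perm.inv_eq_iff_eq.2 (s_shift _).symm
  simp only [t_succ_of_ne hi, Perm.mul_apply, s_shift, extendSym_incl, hs, extendSym_shift]

end Generators

section Bits

/-- The binary digits of `x - 1`, lowest digit first, as a vector over `𝔽₂`. -/
def bits (n : ℕ) (x : X n) : Fin n → ZMod 2 := fun j => if (x.1 - 1).testBit j then 1 else 0

theorem bits_apply_eq_iff {n : ℕ} {x y : X n} {j : Fin n} :
    bits n x j = bits n y j ↔ (x.1 - 1).testBit j = (y.1 - 1).testBit j := by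
  unfold bits
  rcases (x.1 - 1).testBit j <;> rcases (y.1 - 1).testBit j <;> simp

theorem sub_one_lt {n : ℕ} (x : X n) : x.1 - 1 < 2 ^ n := by
  have := x.2
  omega

theorem div_eq_div_iff_bits_sub_mem {n i : ℕ} {x y : X n} :
    (x.1 - 1) / 2 ^ i = (y.1 - 1) / 2 ^ i ↔ bits n x - bits n y ∈ stdFlag (ZMod 2) n i := by
  simp only [mem_stdFlag, Pi.sub_apply, sub_eq_zero, bits_apply_eq_iff]
  constructor
  · intro h j hj
    simpa only [Nat.testBit_div_two_pow, Nat.sub_add_cancel hj]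
      using congr(Nat.testBit $h (j.1 - i))
  · intro h
    refine Nat.eq_of_testBit_eq fun k => ?_
    rw [Nat.testBit_div_two_pow, Nat.testBit_div_two_pow]
    rcases lt_or_ge (k + i) n with hk | hk
    · exact h ⟨k + i, hk⟩ (Nat.le_add_left i k)
    · have hpow : 2 ^ n ≤ 2 ^ (k + i) := Nat.pow_le_pow_right two_pos hk
      rw [Nat.testBit_lt_two_pow ((sub_one_lt x).trans_le hpow),
        Nat.testBit_lt_two_pow ((sub_one_lt y).trans_le hpow)]

theorem bits_bijective (n : ℕ) : Function.Bijective (bits n) := by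
  refine (Fintype.bijective_iff_injective_and_card _).2 ⟨fun x y h => ?_, ?_⟩
  · have hdiv : (x.1 - 1) / 2 ^ 0 = (y.1 - 1) / 2 ^ 0 :=
      div_eq_div_iff_bits_sub_mem.2 (by simp [h])
    have := x.2
    have := y.2
    exact Subtype.ext (by omega)
  · simp [card_X]

theorem bits_incl {n : ℕ} (y : X n) : bits (n + 1) (incl n y) = Fin.snoc (bits n y) 0 := by
  ext j
  induction j using Fin.lastCases with
  | last => simp [bits, incl, Nat.testBit_lt_two_pow (sub_one_lt y)]
  | cast j =>
    rw [Fin.snoc_castSucc]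
    rfl

theorem bits_shift {n : ℕ} (y : X n) : bits (n + 1) (shift n y) = Fin.snoc (bits n y) 1 := by
  have hval : (shift n y).1 - 1 = 2 ^ n + (y.1 - 1) := by
    have := y.2
    simp only [shift]
    omega
  ext j
  induction j using Fin.lastCases with
  | last =>
    simp [bits, hval, Nat.testBit_two_pow_add_eq, Nat.testBit_lt_two_pow (sub_one_lt y)]
  | cast j => simp [bits, hval, Nat.testBit_two_pow_add_gt j.2]

theorem snoc_add_single_castSucc {M : Type*} [AddMonoid M] {n : ℕ} (v : Fin n → M) (c : M)
    (a : Fin n) (b : M) :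
    (Fin.snoc (v + Pi.single a b) c : Fin (n + 1) → M) =
      Fin.snoc v c + Pi.single a.castSucc b := by
  ext j
  induction j using Fin.lastCases with
  | last => simp
  | cast j => simp [Pi.single_apply]

theorem snoc_add_single_last {M : Type*} [AddMonoid M] {n : ℕ} (v : Fin n → M) (c b : M) :
    (Fin.snoc v c : Fin (n + 1) → M) + Pi.single (Fin.last n) b = Fin.snoc v (c + b) := by
  ext j
  induction j using Fin.lastCases with
  | last => simp
  | cast j => simp

theorem bits_t {n : ℕ} (a : Fin n) (x : X n) :
    bits n (t n (a + 1) x) = bits n x + Pi.single a 1 := by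
  induction n with
  | zero => exact a.elim0
  | succ n ih =>
    induction a using Fin.lastCases with
    | last =>
      rw [Fin.val_last, t_succ_self]
      rcases exists_incl_or_shift x with ⟨y, rfl⟩ | ⟨y, rfl⟩
      · rw [s_incl, bits_incl, bits_shift, snoc_add_single_last, zero_add]
      · rw [s_shift, bits_incl, bits_shift, snoc_add_single_last, ZModModule.add_self]
    | cast a =>
      have ha : a.1 + 1 ≠ n + 1 := by omega
      rw [Fin.val_castSucc]
      rcases exists_incl_or_shift x with ⟨y, rfl⟩ | ⟨y, rfl⟩
      · rw [t_succ_incl ha, bits_incl, bits_incl, ih, snoc_add_single_castSucc]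
      · rw [t_succ_shift ha, bits_shift, bits_shift, ih, snoc_add_single_castSucc]

/-- The isomorphism of `Sym(2^n)` with the group of permutations of `𝔽₂ⁿ` given by the binary
digits of the letters. -/
noncomputable def symEquiv (n : ℕ) : Sym n ≃* Perm (Fin n → ZMod 2) :=
  (Equiv.ofBijective _ (bits_bijective n)).permCongrHom

theorem symEquiv_apply_bits {n : ℕ} (f : Sym n) (x : X n) :
    symEquiv n f (bits n x) = bits n (f x) :=
  congrArg (fun y => bits n (f y)) (Equiv.ofBijective_symm_apply_apply _ (bits_bijective n) x)

theorem symEquiv_t {n : ℕ} (a : Fin n) :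
    symEquiv n (t n (a + 1)) = Equiv.addLeft (Pi.single a 1) := by
  ext1 v
  obtain ⟨x, rfl⟩ := (bits_bijective n).2 v
  rw [symEquiv_apply_bits, bits_t, Equiv.coe_addLeft, add_comm]

end Bits

section Transport

theorem map_Tflag {n i : ℕ} (hi : i ≤ n) :
    (Tflag n i).map (symEquiv n).toMonoidHom =
      translations (stdFlag (ZMod 2) n i).toAddSubgroup := by
  apply le_antisymm
  · rw [Subgroup.map_le_iff_le_comap, Tflag, Subgroup.closure_le]
    rintro _ ⟨j, hj, hji, rfl⟩
    obtain ⟨a, rfl⟩ := Nat.exists_eq_add_of_le' hj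
    have ha : a < n := by omega
    exact mem_translations.2 ⟨Pi.single ⟨a, ha⟩ 1, single_mem_stdFlag hji 1,
      (symEquiv_t ⟨a, ha⟩).symm⟩
  · set P := (Tflag n i).map (symEquiv n).toMonoidHom
    have hle : stdFlag (ZMod 2) n i ≤ AddSubgroup.toZModSubmodule 2 (translationVectors P) :=
      stdFlag_le_iff.2 fun a ha => mem_translationVectors.2
        ⟨t n (a + 1), Subgroup.subset_closure ⟨a + 1, Nat.le_add_left 1 a, ha, rfl⟩, symEquiv_t a⟩
    exact translations_le_iff.2 hle

theorem map_T (n : ℕ) :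
    (T n).map (symEquiv n).toMonoidHom = translations (⊤ : AddSubgroup (Fin n → ZMod 2)) := by
  rw [T, map_Tflag le_rfl, stdFlag_eq_top le_rfl, Submodule.top_toAddSubgroup]

open scoped Pointwise in
theorem inv_smul_classes {G α : Type*} [Group G] [MulAction G α] (r : Setoid α) (u : G) :
    u⁻¹ • r.classes = (r.comap (u • ·)).classes := by
  have inv_smul_class (y : α) : u⁻¹ • {x | r x (u • y)} = {x | r.comap (u • ·) x y} := by
    ext x
    rw [Set.mem_inv_smul_set_iff]
    rfl
  ext B
  constructor
  · rintro ⟨_, ⟨z, rfl⟩, rfl⟩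
    exact ⟨u⁻¹ • z, by simpa only [smul_inv_smul] using inv_smul_class (u⁻¹ • z)⟩
  · rintro ⟨y, rfl⟩
    exact ⟨_, r.mem_classes (u • y), inv_smul_class y⟩

open scoped Pointwise in
theorem mem_stabilizer_classes_iff {G α : Type*} [Group G] [MulAction G α] {r : Setoid α} {u : G} :
    u ∈ MulAction.stabilizer G r.classes ↔ ∀ x y, r (u • x) (u • y) ↔ r x y := by
  rw [← inv_mem_iff, MulAction.mem_stabilizer_iff, inv_smul_classes, ← Setoid.classes_inj,
    Setoid.ext_iff]
  rfl

theorem mem_block_iff {n m k : ℕ} {x : X n} :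
    x ∈ block n m k ↔ (x.1 - 1) / 2 ^ (n - m) = k := by
  have := x.2
  rw [Nat.div_eq_iff (by positivity)]
  simp only [block, Set.mem_ofPred_eq]
  have hpos : 0 < 2 ^ (n - m) := by positivity
  rw [add_mul, one_mul]
  omega

theorem block_nonempty {n m k : ℕ} (hm : m ≤ n) (hk : k < 2 ^ m) : (block n m k).Nonempty := by
  have hpos : 0 < 2 ^ (n - m) := by positivity
  have hle : (k + 1) * 2 ^ (n - m) ≤ 2 ^ n := by
    rw [← pow_mul_pow_sub 2 hm]
    gcongr
    omega
  rw [add_mul, one_mul] at hle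
  refine ⟨⟨k * 2 ^ (n - m) + 1, by omega, by omega⟩, ?_⟩
  rw [mem_block_iff, Nat.add_sub_cancel, Nat.mul_div_cancel _ hpos]

theorem blocks_eq_classes {n m : ℕ} (hm : m ≤ n) :
    blocks n m = (Setoid.ker fun x : X n => (x.1 - 1) / 2 ^ (n - m)).classes := by
  ext B
  constructor
  · rintro ⟨k, hk, rfl⟩
    obtain ⟨y, hy⟩ := block_nonempty hm hk
    exact ⟨y, Set.ext fun x => mem_block_iff.trans (by rw [← mem_block_iff.1 hy]; rfl)⟩
  · rintro ⟨y, rfl⟩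
    refine ⟨(y.1 - 1) / 2 ^ (n - m), ?_, Set.ext fun x => ?_⟩
    · rw [Nat.div_lt_iff_lt_mul (by positivity), ← pow_add, Nat.add_sub_cancel' hm]
      exact sub_one_lt y
    · exact mem_block_iff.symm

open scoped Pointwise in
theorem mem_stabilizer_blocks_iff {n i : ℕ} (hi : i ≤ n) {u : Sym n} :
    u ∈ MulAction.stabilizer (Sym n) (blocks n (n - i)) ↔ ∀ v w : Fin n → ZMod 2,
      symEquiv n u v - symEquiv n u w ∈ stdFlag (ZMod 2) n i ↔ v - w ∈ stdFlag (ZMod 2) n i := by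
  rw [blocks_eq_classes (Nat.sub_le n i), mem_stabilizer_classes_iff]
  simp only [(bits_bijective n).2.forall, symEquiv_apply_bits, ← div_eq_div_iff_bits_sub_mem,
    Setoid.ker_def, Perm.smul_def, Nat.sub_sub_self hi]

theorem mem_SigmaGroup_iff {n : ℕ} {u : Sym n} :
    u ∈ SigmaGroup n ↔ ∀ i < n, ∀ v w : Fin n → ZMod 2,
      symEquiv n u v - symEquiv n u w ∈ stdFlag (ZMod 2) n i ↔ v - w ∈ stdFlag (ZMod 2) n i := by
  simp only [SigmaGroup, Subgroup.mem_iInf, Finset.mem_Icc]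
  constructor
  · intro h i hi
    exact (mem_stabilizer_blocks_iff hi.le).1 (h (n - i) (by omega))
  · intro h m hm
    rw [← Nat.sub_sub_self hm.2]
    exact (mem_stabilizer_blocks_iff (Nat.sub_le n m)).2 (h (n - m) (by omega))

theorem map_U (n : ℕ) : (U n).map (symEquiv n).toMonoidHom = flagStabilizer (ZMod 2) n := by
  ext f
  obtain ⟨u, rfl⟩ := (symEquiv n).surjective f
  have hAGL : u ∈ AGL n ↔ symEquiv n u ∈
      Subgroup.normalizer (translations (⊤ : AddSubgroup (Fin n → ZMod 2)) :
        Set (Perm (Fin n → ZMod 2))) := by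
    rw [← map_T, ← Subgroup.map_equiv_normalizer_eq]
    exact (Subgroup.mem_map_iff_mem (symEquiv n).injective).symm
  rw [mem_flagStabilizer_iff, ← hAGL, ← mem_SigmaGroup_iff, ← Subgroup.mem_inf]
  exact Subgroup.mem_map_iff_mem (symEquiv n).injective

end Transport

end SylowChain

theorem mainTheorem6 (n i : ℕ) (hi : i + 2 ≤ n) :
    SylowChain.N n 1 ≤ Subgroup.normalizer (SylowChain.Tflag n i) := by
  intro g hg
  have hgU : SylowChain.symEquiv n g ∈
      Subgroup.normalizer (SylowChain.flagStabilizer (ZMod 2) n) := by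
    rw [← SylowChain.map_U, ← Subgroup.map_equiv_normalizer_eq]
    exact Subgroup.mem_map_of_mem _ hg
  have hgT := SylowChain.mem_normalizer_translations_stdFlag hgU hi
  rw [← SylowChain.map_Tflag (by omega), ← Subgroup.map_equiv_normalizer_eq] at hgT
  exact (Subgroup.mem_map_iff_mem (SylowChain.symEquiv n).injective).1 hgT
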